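/- There is an absolute constant $c>0$ such that the following holds. Let $n\ge 0$ and $k\ge 1$ be integers, let $T\subset\mathbb{R}^n$ be compact, and let $f=(f(t))_{t\in T}$ be a mean-zero Gaussian process whose covariance function $C(s,t)=\mathbb{E}[f(s)f(t)]$ is Lipschitz on $T\times T$. Let $D_C(s,t)=\big(\mathbb{E}(f(s)-f(t))^2\big)^{1/2}$ be its canonical pseudometric, let $\Delta=\operatorname{diam}(T,D_C)=\sup_{s,t\in T}D_C(s,t)$ (with $\Delta=0$ if $T=\emptyset$), and for $\epsilon>0$ let $\mathcal{N}(T,D_C;\epsilon)$ be the smallest number of closed $D_C$-balls of radius $\epsilon$ with centers in $T$ that cover $T$. Let $f_1,\dots,f_k$ be independent copies of $f$ on a probability space, and let $$h^k(x)=\frac{1}{\sqrt k}\,(f_1(x),\dots,f_k(x))\in\mathbb{R}^k,\qquad x\in T.$$ Then $\Delta<\infty$, $\mathcal{N}(T,D_C;\epsilon)<\infty$ for every $\epsilon>0$, the function $\epsilon\mapsto\log(\mathcal{N}(T,D_C;\epsilon)+1)$ is integrable on $(0,\Delta)$, and for every countable set $S\subseteq T$ $$\mathbb{E}\sup_{x,y\in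 S}\Big|\,\|h^k(x)-h^k(y)\|^2-D_C(x,y)^2\Big|\;\le\;\frac{c\,\Delta}{\sqrt k}\int_0^{\Delta}\log\big(\mathcal{N}(T,D_C;\epsilon)+1\big)\,d\epsilon .$$ Moreover, if $f_1,\dots,f_k$ almost surely have continuous sample paths, then the supremum over all $x,y\in T$ is a random variable (measurable with respect to the completed $\sigma$-algebra), and $$\mathbb{E}\sup_{x,y\in T}\Big|\,\|h^k(x)-h^k(y)\|^2-D_C(x,y)^2\Big|\;\le\;\frac{c\,\Delta}{\sqrt k}\int_0^{\Delta}\log\big(\mathcal{N}(T,D_C;\epsilon)+1\big)\,d\epsilon .$$ (Suprema over the empty set are $0$.) -/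

import Mathlib

open MeasureTheory ProbabilityTheory
open scoped ENNReal NNReal

noncomputable section

namespace GPEmbedding

/-- The covariance function `C(s,t) = E[f(s) f(t)]` of a zero-mean random process. -/
def covFun {T Ω : Type*} [MeasurableSpace Ω] (f : T → Ω → ℝ) (P : Measure Ω) (s t : T) : ℝ :=
  ∫ ω, f s ω * f t ω ∂P

/-- The canonical (pseudo)metric `D_C(s,t) = (E (f(s) - f(t))²)^{1/2}` of a random process. -/
def canonicalDist {T Ω : Type*} [MeasurableSpace Ω] (f : T → Ω → ℝ) (P : Measure Ω)
    (s t : T) : ℝ :=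
  √(∫ ω, (f s ω - f t ω) ^ 2 ∂P)

/-- The diameter `sup_{s,t} d(s,t)` of a space `T` for a pseudometric `d`, here an explicit
function (the supremum is that of a bounded set whenever it is used, and it is `0` for empty
`T`). -/
def diam {T : Type*} (d : T → T → ℝ) : ℝ := ⨆ p : T × T, d p.1 p.2

/-- The covering number `𝒩(T,d;ε)`: the smallest number of (closed) balls of radius `ε`,
with centers in `T`, whose union is `T`; it is `⊤` if there is no finite covering. -/
def coveringNumber {T : Type*} (d : T → T → ℝ) (ε : ℝ) : ℕ∞ :=
  ⨅ (A : Set T) (_ : ∀ x, ∃ y ∈ A, d x y ≤ ε), A.encard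

/-- The entropy integrand `log (𝒩(T,d;ε) + 1)`. -/
def logEntropy {T : Type*} (d : T → T → ℝ) (ε : ℝ) : ℝ :=
  Real.log (((coveringNumber d ε).toNat : ℝ) + 1)

/-- The random map `h^k(x) = k^{-1/2} (f₁(x), …, f_k(x))` into Euclidean space `ℝᵏ`. -/
def embed {T Ω : Type*} {k : ℕ} (F : Fin k → T → Ω → ℝ) (x : T) (ω : Ω) :
    EuclideanSpace ℝ (Fin k) :=
  (1 / √(k : ℝ)) • WithLp.toLp 2 (fun i => F i x ω)

/-- `f₁, …, f_k` are independent copies of the process `f`: as random elements of `T → ℝ` with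
the product σ-algebra, they are independent and each has the law of `f`. -/
structure IsIndepCopies {T Ω Ω' : Type*} [MeasurableSpace Ω] [MeasurableSpace Ω'] {k : ℕ}
    (F : Fin k → T → Ω → ℝ) (P : Measure Ω) (f : T → Ω' → ℝ) (P' : Measure Ω') : Prop where
  identDistrib : ∀ i, IdentDistrib (fun ω t => F i t ω) (fun ω t => f t ω) P P'
  indep : iIndepFun (fun i ω t => F i t ω) P

/-- The random variable `sup_{x,y ∈ S} | ‖h^k(x) - h^k(y)‖² - D(x,y)² |`, with values in
`[0,∞]`. -/
def supDeviation {T Ω : Type*} {k : ℕ} (F : Fin k → T → Ω → ℝ) (D : T → T → ℝ) (S : Set T)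
    (ω : Ω) : ℝ≥0∞ :=
  ⨆ (x ∈ S) (y ∈ S), ENNReal.ofReal |‖embed F x ω - embed F y ω‖ ^ 2 - D x y ^ 2|

/-- The quantity `diam(T,D) / √k · ∫₀^{diam(T,D)} log (𝒩(T,D;ε) + 1) dε`. -/
def entropyBound {T : Type*} (D : T → T → ℝ) (k : ℕ) : ℝ :=
  diam D / √(k : ℝ) * ∫ ε in (0 : ℝ)..diam D, logEntropy D ε

end GPEmbedding

end

/-!
The deviation `Z (x, y) = ‖h^k(x) - h^k(y)‖² - D(x, y)²` is an average of `k` independent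
centered copies of `(f x - f y)² - D(x, y)²`. The difference of two such terms, at `(x, y)` and
`(x', y')`, involves `(f x - f y)² - (f x' - f y')²`, which factors as a product of two Gaussian
variables: a sum of `L²` norm at most `2 Δ`, and a difference of `L²` norm at most `2 r`, where
`r = max (D(x, x')) (D(y, y'))`. A product of Gaussians is sub-exponential, and Bernstein's
argument gains a factor `1 / √k` from averaging `k` independent ones, so `Z` has sub-exponential
increments at scale `Δ r / √k`. Dudley's chaining then bounds the expected supremum of `|Z|` by
`Δ / √k` times the entropy integral of `T × T`, whose covering numbers are at most the squares of
those of `T`. The integrand is `log (𝒩 + 1)` instead of its square root because the tails are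
sub-exponential and not sub-Gaussian.
-/

namespace GPEmbedding

open Real Set Filter Topology Module

section ExponentialMoments

lemma lintegral_exp_sq_gaussianReal_zero_le {v : ℝ≥0} {s : ℝ} (hv : v ≤ s ^ 2) :
    ∫⁻ x, .ofReal (exp (x ^ 2 / (4 * s ^ 2))) ∂gaussianReal 0 v ≤ .ofReal √2 := by
  obtain rfl | hv0 := eq_or_ne v 0
  · simp
  have : (0 : ℝ) < v := by positivity
  have density_mul_exp (x : ℝ) : gaussianPDFReal 0 v x * exp (x ^ 2 / (4 * v)) =
      (√(2 * π * v))⁻¹ * exp (-(4 * v : ℝ)⁻¹ * x ^ 2) := by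
    rw [gaussianPDFReal, mul_assoc, ← exp_add]
    congr 2
    field
  calc ∫⁻ x, .ofReal (exp (x ^ 2 / (4 * s ^ 2))) ∂gaussianReal 0 v
    _ ≤ ∫⁻ x, .ofReal (exp (x ^ 2 / (4 * v))) ∂gaussianReal 0 v := by gcongr
    _ = ∫⁻ x, .ofReal ((√(2 * π * v))⁻¹ * exp (-(4 * v : ℝ)⁻¹ * x ^ 2)) := by
      rw [gaussianReal_of_var_ne_zero _ hv0,
        lintegral_withDensity_eq_lintegral_mul _ (measurable_gaussianPDF 0 v) (by fun_prop)]
      simp only [Pi.mul_apply, gaussianPDF, ← ENNReal.ofReal_mul (gaussianPDFReal_nonneg 0 v _),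
        density_mul_exp]
    _ = .ofReal ((√(2 * π * v))⁻¹ * √(π / (4 * v : ℝ)⁻¹)) := by
      rw [← ofReal_integral_eq_lintegral_ofReal
          ((integrable_exp_neg_mul_sq (by positivity)).const_mul _)
          (.of_forall fun x => by positivity), integral_const_mul, integral_gaussian]
    _ = .ofReal √2 := by
      rw [← sqrt_inv, ← sqrt_mul (by positivity)]
      congr 2
      field

lemma exp_sq_add_div_le {m s : ℝ} (hm : m ^ 2 ≤ s ^ 2) (y : ℝ) :
    exp (((m + y) / (3 * s)) ^ 2) ≤ √2 * exp (y ^ 2 / (4 * s ^ 2)) := by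
  have exp_le_sqrt_two : exp (2 / 9) ≤ √2 := by
    refine le_sqrt_of_sq_le ?_
    rw [← exp_nat_mul, ← le_log_iff_exp_le two_pos]
    linarith [log_two_gt_d9]
  have m_div_le : m ^ 2 / s ^ 2 ≤ 1 := div_le_one_of_le₀ hm (sq_nonneg s)
  have exponent_le : ((m + y) / (3 * s)) ^ 2 ≤ 2 / 9 + y ^ 2 / (4 * s ^ 2) := calc
    ((m + y) / (3 * s)) ^ 2
    _ = (m + y) ^ 2 / (9 * s ^ 2) := by ring
    _ ≤ (2 * (m ^ 2 + y ^ 2)) / (9 * s ^ 2) := by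
      gcongr
      exact add_sq_le
    _ = 2 / 9 * (m ^ 2 / s ^ 2) + 2 / 9 * (y ^ 2 / s ^ 2) := by ring
    _ ≤ 2 / 9 * 1 + 1 / 4 * (y ^ 2 / s ^ 2) := by
      have : 0 ≤ y ^ 2 / s ^ 2 := by positivity
      linarith
    _ = 2 / 9 + y ^ 2 / (4 * s ^ 2) := by ring
  calc exp (((m + y) / (3 * s)) ^ 2)
    _ ≤ exp (2 / 9) * exp (y ^ 2 / (4 * s ^ 2)) := by rwa [← exp_add, exp_le_exp]
    _ ≤ √2 * exp (y ^ 2 / (4 * s ^ 2)) := by gcongr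

lemma lintegral_exp_sq_le_two {Ω : Type*} [MeasurableSpace Ω] {P : Measure Ω}
    [IsProbabilityMeasure P] {X : Ω → ℝ} (hX : HasGaussianLaw X P) {s : ℝ}
    (hs : ∫ ω, X ω ^ 2 ∂P ≤ s ^ 2) :
    ∫⁻ ω, .ofReal (exp ((X ω / (3 * s)) ^ 2)) ∂P ≤ 2 := by
  set m := ∫ ω, X ω ∂P with hm
  set v := Var[X; P].toNNReal with hv
  have second_moment : m ^ 2 + v ≤ s ^ 2 := by
    rw [hv, coe_toNNReal _ (variance_nonneg _ _), variance_eq_sub hX.memLp_two]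
    simpa [hm] using hs
  have law : P.map X = (gaussianReal 0 v).map (m + ·) := by
    rw [hX.map_eq_gaussianReal, gaussianReal_map_const_add, zero_add]
  calc ∫⁻ ω, .ofReal (exp ((X ω / (3 * s)) ^ 2)) ∂P
    _ = ∫⁻ y, .ofReal (exp (((m + y) / (3 * s)) ^ 2)) ∂gaussianReal 0 v := by
      rw [← lintegral_map' (f := fun x => .ofReal (exp ((x / (3 * s)) ^ 2))) (by fun_prop)
        hX.aemeasurable, law, lintegral_map (by fun_prop) (by fun_prop)]
    _ ≤ ∫⁻ y, .ofReal √2 * .ofReal (exp (y ^ 2 / (4 * s ^ 2))) ∂gaussianReal 0 v := by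
      refine lintegral_mono fun y => ?_
      rw [← ENNReal.ofReal_mul (sqrt_nonneg 2)]
      exact ENNReal.ofReal_le_ofReal (exp_sq_add_div_le (by linarith [v.2]) y)
    _ ≤ .ofReal √2 * .ofReal √2 := by
      rw [lintegral_const_mul _ (by fun_prop)]
      gcongr
      exact lintegral_exp_sq_gaussianReal_zero_le (by linarith [sq_nonneg m])
    _ = 2 := by
      rw [← ENNReal.ofReal_mul (sqrt_nonneg 2), mul_self_sqrt zero_le_two, ENNReal.ofReal_ofNat]

variable {Ω : Type*} [MeasurableSpace Ω] {P : Measure Ω}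

lemma lintegral_exp_abs_mul_le {U V : Ω → ℝ} (hU : AEMeasurable U P) {K : ℝ≥0∞}
    (hUK : ∫⁻ ω, .ofReal (exp (U ω ^ 2)) ∂P ≤ K) (hVK : ∫⁻ ω, .ofReal (exp (V ω ^ 2)) ∂P ≤ K) :
    ∫⁻ ω, .ofReal (exp |U ω * V ω|) ∂P ≤ K := by
  have young (u v : ℝ) : exp |u * v| ≤ 2⁻¹ * exp (u ^ 2) + 2⁻¹ * exp (v ^ 2) := calc
    exp |u * v| ≤ exp (2⁻¹ * u ^ 2 + 2⁻¹ * v ^ 2) := by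
      rw [exp_le_exp, abs_mul]
      nlinarith [sq_nonneg (|u| - |v|), sq_abs u, sq_abs v]
    _ ≤ 2⁻¹ * exp (u ^ 2) + 2⁻¹ * exp (v ^ 2) :=
      convexOn_exp.2 (mem_univ _) (mem_univ _) (by norm_num) (by norm_num) (by norm_num)
  calc ∫⁻ ω, .ofReal (exp |U ω * V ω|) ∂P
    _ ≤ ∫⁻ ω, (2⁻¹ * .ofReal (exp (U ω ^ 2)) + 2⁻¹ * .ofReal (exp (V ω ^ 2))) ∂P := by
      refine lintegral_mono fun ω => (ENNReal.ofReal_le_ofReal (young _ _)).trans_eq ?_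
      rw [ENNReal.ofReal_add (by positivity) (by positivity), ENNReal.ofReal_mul (by norm_num),
        ENNReal.ofReal_mul (by norm_num), ENNReal.ofReal_inv_of_pos two_pos,
        ENNReal.ofReal_ofNat]
    _ ≤ 2⁻¹ * K + 2⁻¹ * K := by
      rw [lintegral_add_left' (by fun_prop), lintegral_const_mul' _ _ (by simp),
        lintegral_const_mul' _ _ (by simp)]
      gcongr
    _ = K := by rw [← add_mul, ENNReal.inv_two_add_inv_two, one_mul]

lemma integrable_exp_abs {X : Ω → ℝ} (hX : AEMeasurable X P) {B : ℝ≥0}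
    (hB : ∫⁻ ω, .ofReal (exp |X ω|) ∂P ≤ B) : Integrable (fun ω => exp |X ω|) P :=
  (lintegral_ofReal_ne_top_iff_integrable (by fun_prop) (.of_forall fun _ => (exp_pos _).le)).1
    (ne_top_of_le_ne_top ENNReal.coe_ne_top hB)

lemma integral_exp_abs_le {X : Ω → ℝ} (hX : AEMeasurable X P) {B : ℝ≥0}
    (hB : ∫⁻ ω, .ofReal (exp |X ω|) ∂P ≤ B) : ∫ ω, exp |X ω| ∂P ≤ B := by
  rw [integral_eq_lintegral_of_nonneg_ae (.of_forall fun _ => (exp_pos _).le) (by fun_prop)]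
  exact ENNReal.toReal_le_coe_of_le_coe hB

lemma integrable_exp_mul {X : Ω → ℝ} (hX : AEMeasurable X P) {B : ℝ≥0}
    (hB : ∫⁻ ω, .ofReal (exp |X ω|) ∂P ≤ B) {t : ℝ} (ht : |t| ≤ 1) :
    Integrable (fun ω => exp (t * X ω)) P := by
  refine (integrable_exp_abs hX hB).mono' (by fun_prop) (.of_forall fun ω => ?_)
  rw [norm_of_nonneg (exp_pos _).le, exp_le_exp]
  exact (le_abs_self _).trans ((abs_mul _ _).trans_le (mul_le_of_le_one_left (abs_nonneg _) ht))

lemma exp_le_one_add_self_add_sq_mul_exp_abs (x : ℝ) : exp x ≤ 1 + x + x ^ 2 * exp |x| := by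
  have taylor := Complex.norm_exp_sub_sum_le_norm_mul_exp (x : ℂ) 2
  have remainder : Complex.exp x - ∑ m ∈ Finset.range 2, (x : ℂ) ^ m / m.factorial =
      ((exp x - (1 + x) : ℝ) : ℂ) := by
    simp [Finset.sum_range_succ]
  rw [remainder, Complex.norm_real, Complex.norm_real, norm_eq_abs, norm_eq_abs, sq_abs] at taylor
  linarith [le_abs_self (exp x - (1 + x))]

lemma exp_mul_le_one_add_add_exp_abs {t : ℝ} (ht : |t| ≤ 1 / 2) (x : ℝ) :
    exp (t * x) ≤ 1 + t * x + 8 * t ^ 2 * exp |x| := by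
  have sq_le : x ^ 2 ≤ 8 * exp (|x| / 2) := by
    linarith [quadratic_le_exp_of_nonneg (x := |x| / 2) (by positivity), sq_abs x, abs_nonneg x]
  have abs_mul_le : |t * x| ≤ |x| / 2 := by
    rw [abs_mul]
    linarith [mul_le_mul_of_nonneg_right ht (abs_nonneg x)]
  calc exp (t * x)
    _ ≤ 1 + t * x + (t * x) ^ 2 * exp |t * x| := exp_le_one_add_self_add_sq_mul_exp_abs _
    _ ≤ 1 + t * x + t ^ 2 * (8 * exp (|x| / 2)) * exp (|x| / 2) := by
      rw [mul_pow]
      gcongr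
    _ = 1 + t * x + 8 * t ^ 2 * exp |x| := by
      rw [mul_assoc, mul_assoc 8, ← exp_add, add_halves]
      ring

lemma lintegral_exp_abs_sub_integral_le {X : Ω → ℝ} (hX : AEMeasurable X P) {B : ℝ≥0}
    (hB : ∫⁻ ω, .ofReal (exp |X ω|) ∂P ≤ B) :
    ∫⁻ ω, .ofReal (exp |X ω - ∫ ω', X ω' ∂P|) ∂P ≤ ↑(B * (exp B).toNNReal) := by
  have mean_le : |∫ ω, X ω ∂P| ≤ B := calc
    |∫ ω, X ω ∂P| ≤ ∫ ω, exp |X ω| ∂P :=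
      norm_integral_le_of_norm_le (integrable_exp_abs hX hB) (.of_forall fun ω => by
        linarith [add_one_le_exp |X ω|, norm_eq_abs (X ω)])
    _ ≤ B := integral_exp_abs_le hX hB
  calc ∫⁻ ω, .ofReal (exp |X ω - ∫ ω', X ω' ∂P|) ∂P
    _ ≤ ∫⁻ ω, .ofReal (exp |X ω|) * .ofReal (exp B) ∂P := by
      refine lintegral_mono fun ω => ?_
      rw [← ENNReal.ofReal_mul (exp_pos _).le, ← exp_add]
      gcongr
      exact (abs_sub _ _).trans (by gcongr)
    _ ≤ ↑(B * (exp B).toNNReal) := by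
      rw [lintegral_mul_const' _ _ ENNReal.ofReal_ne_top, ENNReal.coe_mul]
      gcongr
      rfl

variable [IsProbabilityMeasure P]

lemma mgf_le_exp_mul_sq {X : Ω → ℝ} (hX : AEMeasurable X P) {B : ℝ≥0}
    (hB : ∫⁻ ω, .ofReal (exp |X ω|) ∂P ≤ B) (hX0 : ∫ ω, X ω ∂P = 0) {t : ℝ} (ht : |t| ≤ 1 / 2) :
    mgf X P t ≤ exp (8 * B * t ^ 2) := by
  have exp_int := integrable_exp_abs hX hB
  have hX_int : Integrable X P := by
    refine exp_int.mono' hX.aestronglyMeasurable (.of_forall fun ω => ?_)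
    linarith [add_one_le_exp |X ω|, norm_eq_abs (X ω)]
  have affine_int : Integrable (fun ω => 1 + t * X ω) P :=
    (integrable_const 1).add (hX_int.const_mul t)
  calc mgf X P t
    _ ≤ ∫ ω, (1 + t * X ω + 8 * t ^ 2 * exp |X ω|) ∂P :=
      integral_mono (integrable_exp_mul hX hB (by linarith))
        (affine_int.add (exp_int.const_mul _)) fun ω => exp_mul_le_one_add_add_exp_abs ht (X ω)
    _ = 1 + 8 * t ^ 2 * ∫ ω, exp |X ω| ∂P := by
      rw [integral_add affine_int (exp_int.const_mul _), integral_const_mul,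
        integral_add (integrable_const 1) (hX_int.const_mul t), integral_const_mul, hX0]
      simp
    _ ≤ 1 + 8 * t ^ 2 * B := by
      gcongr
      exact integral_exp_abs_le hX hB
    _ ≤ exp (8 * B * t ^ 2) := by linarith [add_one_le_exp (8 * B * t ^ 2)]

section Sum

variable {ι : Type*} [Fintype ι] {X : ι → Ω → ℝ} {B : ℝ≥0}

lemma lintegral_exp_mul_sum_le (hind : iIndepFun X P) (hX : ∀ i, AEMeasurable (X i) P)
    (hB : ∀ i, ∫⁻ ω, .ofReal (exp |X i ω|) ∂P ≤ B) (hX0 : ∀ i, ∫ ω, X i ω ∂P = 0) {t : ℝ}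
    (ht : |t| ≤ 1 / 2) :
    ∫⁻ ω, .ofReal (exp (t * ∑ i, X i ω)) ∂P ≤
      .ofReal (exp (8 * B * t ^ 2 * Fintype.card ι)) := by
  have mgf_sum : mgf (∑ i, X i) P t = ∏ i, mgf (X i) P t := hind.mgf_sum₀ hX Finset.univ
  have mgf_sum_pos : 0 < mgf (∑ i, X i) P t := mgf_sum ▸
    Finset.prod_pos fun i _ => mgf_pos (integrable_exp_mul (hX i) (hB i) (by linarith))
  have sum_int : Integrable (fun ω => exp (t * (∑ i, X i) ω)) P :=
    not_imp_comm.1 integral_undef mgf_sum_pos.ne'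
  simp only [← Finset.sum_apply]
  rw [← ofReal_integral_eq_lintegral_ofReal sum_int (.of_forall fun ω => (exp_pos _).le)]
  refine ENNReal.ofReal_le_ofReal ?_
  calc mgf (∑ i, X i) P t
    _ = ∏ i, mgf (X i) P t := mgf_sum
    _ ≤ ∏ _i : ι, exp (8 * B * t ^ 2) := by
      gcongr with i
      · exact fun _ _ => mgf_nonneg
      · exact mgf_le_exp_mul_sq (hX i) (hB i) (hX0 i) ht
    _ = exp (8 * B * t ^ 2 * Fintype.card ι) := by
      rw [Finset.prod_const, Finset.card_univ, ← exp_nat_mul, mul_comm]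

lemma lintegral_exp_abs_sum_div_le (hind : iIndepFun X P) (hX : ∀ i, AEMeasurable (X i) P)
    (hB : ∀ i, ∫⁻ ω, .ofReal (exp |X i ω|) ∂P ≤ B) (hX0 : ∀ i, ∫ ω, X i ω ∂P = 0) :
    ∫⁻ ω, .ofReal (exp (|∑ i, X i ω| / (2 * √(Fintype.card ι)))) ∂P ≤
      .ofReal (2 * exp (2 * B)) := by
  set n := Fintype.card ι
  set t : ℝ := (2 * √n)⁻¹ with t_def
  have t_sq_mul : t ^ 2 * n ≤ 1 / 4 := by
    rw [t_def, inv_pow, mul_pow, sq_sqrt (Nat.cast_nonneg n), mul_inv, mul_assoc]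
    linarith [inv_mul_le_one (a := (n : ℝ))]
  have t_le : |t| ≤ 1 / 2 := by
    rw [t_def, mul_inv, abs_of_nonneg (by positivity)]
    have : (√n)⁻¹ ≤ 1 := by
      obtain h | h := n.eq_zero_or_pos
      · simp [h]
      · exact inv_le_one_of_one_le₀ (one_le_sqrt.2 (mod_cast h))
    linarith
  have exp_le : exp (8 * B * t ^ 2 * n) ≤ exp (2 * B) := by
    rw [exp_le_exp]
    nlinarith [B.2]
  calc ∫⁻ ω, .ofReal (exp (|∑ i, X i ω| / (2 * √n))) ∂P
    _ ≤ ∫⁻ ω, (.ofReal (exp (t * ∑ i, X i ω)) + .ofReal (exp (-t * ∑ i, X i ω))) ∂P := by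
      refine lintegral_mono fun ω => ?_
      rw [← ENNReal.ofReal_add (exp_pos _).le (exp_pos _).le, div_eq_inv_mul, neg_mul]
      refine ENNReal.ofReal_le_ofReal (le_of_eq_of_le ?_ (exp_abs_le _))
      rw [abs_mul, abs_of_nonneg (by positivity : 0 ≤ t)]
    _ ≤ .ofReal (exp (2 * B)) + .ofReal (exp (2 * B)) := by
      rw [lintegral_add_left' (by fun_prop)]
      gcongr
      · exact (lintegral_exp_mul_sum_le hind hX hB hX0 t_le).trans
          (ENNReal.ofReal_le_ofReal exp_le)
      · refine (lintegral_exp_mul_sum_le hind hX hB hX0 (by rwa [abs_neg])).trans ?_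
        rw [neg_sq]
        exact ENNReal.ofReal_le_ofReal exp_le
    _ = .ofReal (2 * exp (2 * B)) := by
      rw [← ENNReal.ofReal_add (exp_pos _).le (exp_pos _).le, ← two_mul]

end Sum

end ExponentialMoments

section CoveringNumber

variable {T : Type*} {d : T → T → ℝ} {ε ε' : ℝ}

lemma coveringNumber_le_encard {A : Set T} (hA : ∀ x, ∃ y ∈ A, d x y ≤ ε) :
    coveringNumber d ε ≤ A.encard :=
  iInf₂_le A hA

lemma exists_encard_eq_coveringNumber (h : coveringNumber d ε < ⊤) :
    ∃ A : Set T, (∀ x, ∃ y ∈ A, d x y ≤ ε) ∧ A.encard = coveringNumber d ε := by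
  have : Nonempty {A : Set T // ∀ x, ∃ y ∈ A, d x y ≤ ε} := by
    by_contra hempty
    refine h.ne (iInf₂_eq_top.2 fun A hA => (hempty ⟨A, hA⟩).elim)
  obtain ⟨A, hA⟩ := ENat.exists_eq_iInf fun A : {A : Set T // ∀ x, ∃ y ∈ A, d x y ≤ ε} =>
    A.1.encard
  exact ⟨A, A.2, hA.trans iInf_subtype⟩

lemma exists_finset_card_eq_coveringNumber (h : coveringNumber d ε < ⊤) :
    ∃ s : Finset T, (∀ x, ∃ y ∈ s, d x y ≤ ε) ∧ s.card = (coveringNumber d ε).toNat := by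
  obtain ⟨A, hA, hcard⟩ := exists_encard_eq_coveringNumber h
  have hfin : A.Finite := encard_lt_top_iff.1 (hcard ▸ h)
  refine ⟨hfin.toFinset, by simpa using hA, ?_⟩
  rw [← hcard, hfin.encard_eq_coe_toFinset_card, ENat.toNat_natCast]

lemma coveringNumber_mono {d' : T → T → ℝ} (h : ∀ x y, d' x y ≤ ε' → d x y ≤ ε) :
    coveringNumber d ε ≤ coveringNumber d' ε' :=
  le_iInf₂ fun _ hA => coveringNumber_le_encard fun x =>
    (hA x).imp fun y hy => ⟨hy.1, h x y hy.2⟩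

lemma antitoneOn_logEntropy (h : ∀ ε, 0 < ε → coveringNumber d ε < ⊤) :
    AntitoneOn (logEntropy d) (Ioi 0) := fun ε hε ε' _ hle => by
  rw [logEntropy, logEntropy]
  gcongr
  exacts [(h ε hε).ne, coveringNumber_mono fun x y hxy => hxy.trans hle]

lemma logEntropy_nonneg : 0 ≤ logEntropy d ε :=
  log_nonneg (by simp)

end CoveringNumber

section MaximalInequality

variable {Ω : Type*} [MeasurableSpace Ω] {P : Measure Ω}

-- Summing this over `N` variables trades their supremum for an average of exponentials.
lemma le_mul_log_add_div_mul_exp {b N : ℝ} (hb : 0 < b) (hN : 0 < N) (x : ℝ) :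
    x ≤ b * log N + b / N * exp (x / b) := calc
  x = b * (log N + (x / b - log N)) := by field_simp; ring
  _ ≤ b * (log N + exp (x / b - log N)) := by
    gcongr
    linarith [add_one_le_exp (x / b - log N)]
  _ = b * log N + b / N * exp (x / b) := by
    rw [exp_sub, exp_log hN]
    ring

lemma lintegral_iSup_finset_le [IsProbabilityMeasure P] {ι : Type*} (s : Finset ι)
    {X : ι → Ω → ℝ} {b : ℝ} (hb : 0 < b) {K : ℝ≥0} (hX : ∀ i ∈ s, AEMeasurable (X i) P)
    (hK : ∀ i ∈ s, ∫⁻ ω, .ofReal (exp (X i ω / b)) ∂P ≤ K) :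
    ∫⁻ ω, ⨆ i ∈ s, .ofReal (X i ω) ∂P ≤ .ofReal ((1 + 2 * K) * b * log (s.card + 1)) := by
  obtain rfl | hs := s.eq_empty_or_nonempty
  · simp
  set N : ℝ := s.card + 1 with N_def
  have N_pos : 0 < N := N_def ▸ by positivity
  have card_pos : (1 : ℝ) ≤ s.card := mod_cast hs.card_pos
  have half_le_log : 1 / 2 ≤ log N := by
    linarith [log_two_gt_d9, log_le_log two_pos (by linarith : 2 ≤ N)]
  calc ∫⁻ ω, ⨆ i ∈ s, .ofReal (X i ω) ∂P
    _ ≤ ∫⁻ ω, (.ofReal (b * log N) + .ofReal (b / N) * ∑ i ∈ s, .ofReal (exp (X i ω / b))) ∂P := by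
      refine lintegral_mono fun ω => iSup₂_le fun i hi => ?_
      refine (ENNReal.ofReal_le_ofReal (le_mul_log_add_div_mul_exp hb N_pos (X i ω))).trans ?_
      rw [ENNReal.ofReal_add (by positivity) (by positivity),
        ENNReal.ofReal_mul (by positivity : 0 ≤ b / N)]
      gcongr
      exact Finset.single_le_sum (f := fun i => ENNReal.ofReal (exp (X i ω / b)))
        (fun _ _ => zero_le) hi
    _ = .ofReal (b * log N) +
        .ofReal (b / N) * ∑ i ∈ s, ∫⁻ ω, .ofReal (exp (X i ω / b)) ∂P := by
      rw [lintegral_add_left measurable_const, lintegral_const, measure_univ, mul_one,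
        lintegral_const_mul' _ _ ENNReal.ofReal_ne_top, lintegral_finsetSum' _ fun i hi => by
          have := hX i hi
          fun_prop]
    _ ≤ .ofReal (b * log N) + .ofReal (b / N) * (s.card • .ofReal K) := by
      gcongr
      exact Finset.sum_le_card_nsmul _ _ _ fun i hi => (hK i hi).trans_eq
        ENNReal.ofReal_coe_nnreal.symm
    _ = .ofReal (b * (log N + s.card / N * K)) := by
      rw [← ENNReal.ofReal_nsmul, ← ENNReal.ofReal_mul (by positivity),
        ← ENNReal.ofReal_add (by positivity) (by positivity), nsmul_eq_mul]
      congr 1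
      ring
    _ ≤ .ofReal ((1 + 2 * K) * b * log N) := by
      refine ENNReal.ofReal_le_ofReal ?_
      have : s.card / N * K ≤ 1 * (K : ℝ) := by
        gcongr
        exact div_le_one_of_le₀ (by linarith) (by linarith)
      rw [mul_comm (_ + _) b, mul_assoc]
      gcongr
      nlinarith [K.2]

lemma lintegral_biSup_le_of_forall_finset {ι : Type*} {S : Set ι} (hS : S.Countable)
    {X : ι → Ω → ℝ≥0∞} (hX : ∀ i, AEMeasurable (X i) P) {M : ℝ≥0∞}
    (hM : ∀ s : Finset ι, ∫⁻ ω, ⨆ i ∈ s, X i ω ∂P ≤ M) : ∫⁻ ω, ⨆ i ∈ S, X i ω ∂P ≤ M := by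
  classical
  have := hS.to_subtype
  have measurable_partial (s : Finset S) : AEMeasurable (fun ω => ⨆ i ∈ s, X i ω) P :=
    .biSup (s : Set S) s.countable_toSet (f := fun i ω => X i ω) fun i _ => hX i
  have directed : Directed (· ≤ ·) fun (s : Finset S) ω => ⨆ i ∈ s, X i ω :=
    Monotone.directed_le fun s t hst ω => biSup_mono fun _ => Finset.mem_of_subset hst
  have iSup_eq (ω : Ω) : ⨆ i ∈ S, X i ω = ⨆ s : Finset S, ⨆ i ∈ s, X i ω := by
    rw [← iSup_subtype'', iSup_eq_iSup_finset]
  rw [lintegral_congr iSup_eq, lintegral_iSup_directed measurable_partial directed]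
  exact iSup_le fun s => by simpa only [Finset.iSup_finset_image] using hM (s.image (↑))

end MaximalInequality

section DyadicSum

lemma dyadic_sum_le_lintegral {g : ℝ → ℝ≥0∞} (hg : AntitoneOn g (Ioi 0)) {Δ : ℝ} (hΔ : 0 < Δ)
    (J : ℕ) :
    ∑ j ∈ Finset.range J, .ofReal (Δ / 2 ^ j) * g (Δ / 2 ^ (j + 1)) ≤
      4 * ∫⁻ ε in Ioc 0 Δ, g ε := by
  let I (j : ℕ) := Ioc (Δ / 2 ^ (j + 2)) (Δ / 2 ^ (j + 1))
  have I_disjoint : Pairwise (Function.onFun Disjoint I) :=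
    Antitone.pairwise_disjoint_on_Ioc_succ (f := fun j => Δ / 2 ^ (j + 1))
      (antitone_nat_of_succ_le fun j => by gcongr <;> norm_num)
  have I_subset (j : ℕ) : I j ⊆ Ioc 0 Δ :=
    Ioc_subset_Ioc (by positivity) (div_le_self hΔ.le (one_le_pow₀ one_le_two))
  have term_le (j : ℕ) : .ofReal (Δ / 2 ^ j) * g (Δ / 2 ^ (j + 1)) ≤ 4 * ∫⁻ ε in I j, g ε := calc
    .ofReal (Δ / 2 ^ j) * g (Δ / 2 ^ (j + 1))
    _ = 4 * ∫⁻ _ in I j, g (Δ / 2 ^ (j + 1)) := by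
      rw [setLIntegral_const, volume_Ioc, mul_comm (g _), ← mul_assoc,
        ← ENNReal.ofReal_ofNat, ← ENNReal.ofReal_mul (by norm_num)]
      congr 2
      ring
    _ ≤ 4 * ∫⁻ ε in I j, g ε := by
      gcongr 4 * ?_
      exact setLIntegral_mono' measurableSet_Ioc fun ε hε =>
        hg ((by positivity : 0 < Δ / 2 ^ (j + 2)).trans hε.1) (mem_Ioi.2 (by positivity)) hε.2
  calc ∑ j ∈ Finset.range J, .ofReal (Δ / 2 ^ j) * g (Δ / 2 ^ (j + 1))
    _ ≤ 4 * ∑ j ∈ Finset.range J, ∫⁻ ε in I j, g ε := by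
      rw [Finset.mul_sum]
      exact Finset.sum_le_sum fun j _ => term_le j
    _ = 4 * ∫⁻ ε in ⋃ j ∈ Finset.range J, I j, g ε := by
      rw [lintegral_biUnion_finset (I_disjoint.set_pairwise _) fun _ _ => measurableSet_Ioc]
    _ ≤ 4 * ∫⁻ ε in Ioc 0 Δ, g ε := by
      gcongr
      exact iUnion₂_subset fun j _ => I_subset j

end DyadicSum

/-- The process `Z` has sub-exponential increments at scale `a ρ`: whenever `ρ u v ≤ r`, the
exponential moment of `dist (Z u) (Z v) / (a r)` is at most `K`. Bounding by every `r ≥ ρ u v`,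
rather than by `ρ u v` itself, avoids a division by zero. -/
structure HasSubexpIncrements {U Ω E : Type*} [MeasurableSpace Ω] [PseudoMetricSpace E]
    (Z : U → Ω → E) (ρ : U → U → ℝ) (a : ℝ) (K : ℝ≥0) (P : Measure Ω) : Prop where
  scale_pos : 0 < a
  aemeasurable_dist : ∀ u v, AEMeasurable (fun ω => dist (Z u ω) (Z v ω)) P
  lintegral_exp_le : ∀ u v r, 0 < r → ρ u v ≤ r →
    ∫⁻ ω, .ofReal (exp (dist (Z u ω) (Z v ω) / (a * r))) ∂P ≤ K

namespace HasSubexpIncrements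

variable {U Ω E : Type*} [MeasurableSpace Ω] [PseudoMetricSpace E] {Z : U → Ω → E}
  {ρ : U → U → ℝ} {a : ℝ} {K : ℝ≥0} {P : Measure Ω}

lemma aemeasurable_edist (h : HasSubexpIncrements Z ρ a K P) (u v : U) :
    AEMeasurable (fun ω => edist (Z u ω) (Z v ω)) P := by
  simpa only [edist_dist] using (h.aemeasurable_dist u v).ennreal_ofReal

variable [IsProbabilityMeasure P]

lemma lintegral_iSup_edist_le (h : HasSubexpIncrements Z ρ a K P) (s : Finset U) {proj : U → U}
    {r : ℝ} (hr : 0 ≤ r) (h_proj : ∀ u ∈ s, ρ u (proj u) ≤ r) :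
    ∫⁻ ω, ⨆ u ∈ s, edist (Z u ω) (Z (proj u) ω) ∂P ≤
      .ofReal ((1 + 2 * K) * (a * r) * log (s.card + 1)) := by
  have bound_of_lt (r' : ℝ) (hr' : r < r') :
      ∫⁻ ω, ⨆ u ∈ s, edist (Z u ω) (Z (proj u) ω) ∂P ≤
        .ofReal ((1 + 2 * K) * (a * r') * log (s.card + 1)) := by
    simp only [edist_dist]
    exact lintegral_iSup_finset_le s (mul_pos h.scale_pos (hr.trans_lt hr'))
      (fun u _ => h.aemeasurable_dist u (proj u)) fun u hu =>
        h.lintegral_exp_le u (proj u) r' (hr.trans_lt hr') ((h_proj u hu).trans hr'.le)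
  have bound_tendsto : Tendsto
      (fun r' => ENNReal.ofReal ((1 + 2 * K) * (a * r') * log (s.card + 1)))
      (𝓝[>] r) (𝓝 (.ofReal ((1 + 2 * K) * (a * r) * log (s.card + 1)))) :=
    (ENNReal.continuous_ofReal.comp (by fun_prop)).continuousWithinAt
  exact ge_of_tendsto bound_tendsto (eventually_nhdsWithin_of_forall bound_of_lt)

lemma lintegral_iSup_edist_le_add (h : HasSubexpIncrements Z ρ a K P) (u₀ : U) {s t : Finset U}
    {r : ℝ} (hr : 0 ≤ r) (hst : ∀ u, ∃ v ∈ t, ρ u v ≤ r) :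
    ∫⁻ ω, ⨆ u ∈ s, edist (Z u ω) (Z u₀ ω) ∂P ≤
      .ofReal ((1 + 2 * K) * (a * r) * log (s.card + 1)) +
        ∫⁻ ω, ⨆ v ∈ t, edist (Z v ω) (Z u₀ ω) ∂P := by
  choose proj proj_mem h_proj using hst
  calc ∫⁻ ω, ⨆ u ∈ s, edist (Z u ω) (Z u₀ ω) ∂P
    _ ≤ ∫⁻ ω, ((⨆ u ∈ s, edist (Z u ω) (Z (proj u) ω)) + ⨆ v ∈ t, edist (Z v ω) (Z u₀ ω)) ∂P := by
      gcongr with ω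
      exact iSup₂_le fun u hu => (edist_triangle _ (Z (proj u) ω) _).trans
        (add_le_add (le_iSup₂ (f := fun u _ => edist (Z u ω) (Z (proj u) ω)) u hu)
          (le_iSup₂ (f := fun v _ => edist (Z v ω) (Z u₀ ω)) (proj u) (proj_mem u)))
    _ = ∫⁻ ω, ⨆ u ∈ s, edist (Z u ω) (Z (proj u) ω) ∂P +
        ∫⁻ ω, ⨆ v ∈ t, edist (Z v ω) (Z u₀ ω) ∂P :=
      lintegral_add_left' (.biSup (s : Set U) s.countable_toSet
        (f := fun u ω => edist (Z u ω) (Z (proj u) ω)) fun u _ => h.aemeasurable_edist u (proj u)) _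
    _ ≤ _ := by
      gcongr
      exact h.lintegral_iSup_edist_le s hr fun u _ => h_proj u

/- The chain is built from its fine end: every net projects onto the next coarser one, so `ρ` needs
neither symmetry nor a triangle inequality. -/
lemma lintegral_iSup_finset_edist_le_sum (h : HasSubexpIncrements Z ρ a K P)
    (hN : ∀ ε, 0 < ε → coveringNumber ρ ε < ⊤) {u₀ : U} {Δ : ℝ} (hΔ : 0 < Δ)
    (hu₀ : ∀ u, ρ u u₀ ≤ Δ) (J : ℕ) (s : Finset U) :
    ∫⁻ ω, ⨆ u ∈ s, edist (Z u ω) (Z u₀ ω) ∂P ≤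
      .ofReal ((1 + 2 * K) * (a * (Δ / 2 ^ J)) * log (s.card + 1)) +
        .ofReal ((1 + 2 * K) * a) * ∑ j ∈ Finset.range J,
          .ofReal (Δ / 2 ^ j) * .ofReal (logEntropy ρ (Δ / 2 ^ (j + 1))) := by
  have ha := h.scale_pos
  induction J generalizing s with
  | zero => simpa using h.lintegral_iSup_edist_le s (proj := fun _ => u₀) hΔ.le fun u _ => hu₀ u
  | succ J ih =>
    obtain ⟨t, t_covers, t_card⟩ := exists_finset_card_eq_coveringNumber
      (hN (Δ / 2 ^ (J + 1)) (by positivity))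
    refine (h.lintegral_iSup_edist_le_add u₀ (by positivity) t_covers).trans ?_
    gcongr
    refine (ih t).trans_eq ?_
    rw [t_card, ← logEntropy, Finset.sum_range_succ_comm, mul_add,
      ← ENNReal.ofReal_mul (by positivity), ← ENNReal.ofReal_mul (by positivity)]
    ring_nf

theorem lintegral_biSup_edist_le (h : HasSubexpIncrements Z ρ a K P)
    (hN : ∀ ε, 0 < ε → coveringNumber ρ ε < ⊤) {u₀ : U} {Δ : ℝ} (hΔ : 0 ≤ Δ)
    (hu₀ : ∀ u, ρ u u₀ ≤ Δ) {S : Set U} (hS : S.Countable) :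
    ∫⁻ ω, ⨆ u ∈ S, edist (Z u ω) (Z u₀ ω) ∂P ≤
      4 * .ofReal ((1 + 2 * K) * a) * ∫⁻ ε in Ioc 0 Δ, .ofReal (logEntropy ρ ε) := by
  refine lintegral_biSup_le_of_forall_finset hS (fun u => h.aemeasurable_edist u u₀) fun s => ?_
  obtain rfl | hΔ_pos := hΔ.eq_or_lt
  · simpa using h.lintegral_iSup_edist_le s (proj := fun _ => u₀) le_rfl fun u _ => hu₀ u
  have entropy_antitone : AntitoneOn (fun ε => ENNReal.ofReal (logEntropy ρ ε)) (Ioi 0) :=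
    fun ε hε ε' hε' hle => ENNReal.ofReal_le_ofReal (antitoneOn_logEntropy hN hε hε' hle)
  have partial_bound (J : ℕ) : ∫⁻ ω, ⨆ u ∈ s, edist (Z u ω) (Z u₀ ω) ∂P ≤
      .ofReal ((1 + 2 * K) * (a * (Δ / 2 ^ J)) * log (s.card + 1)) +
        4 * .ofReal ((1 + 2 * K) * a) * ∫⁻ ε in Ioc 0 Δ, .ofReal (logEntropy ρ ε) := by
    refine (h.lintegral_iSup_finset_edist_le_sum hN hΔ_pos hu₀ J s).trans ?_
    rw [mul_comm 4, mul_assoc _ 4]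
    gcongr
    exact dyadic_sum_le_lintegral entropy_antitone hΔ_pos J
  have first_term_tendsto : Tendsto
      (fun J : ℕ => ENNReal.ofReal ((1 + 2 * K) * (a * (Δ / 2 ^ J)) * log (s.card + 1)))
      atTop (𝓝 0) := by
    have : Tendsto (fun J : ℕ => Δ / 2 ^ J) atTop (𝓝 0) :=
      tendsto_const_nhds.div_atTop (tendsto_pow_atTop_atTop_of_one_lt one_lt_two)
    simpa using ENNReal.tendsto_ofReal
      (((this.const_mul a).const_mul (1 + 2 * K : ℝ)).mul_const (log (s.card + 1)))
  simpa using ge_of_tendsto' (first_term_tendsto.add_const _) partial_bound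

end HasSubexpIncrements

section ProductCovering

variable {T : Type*}

/-- The pseudometric `max (d x x') (d y y')` on pairs, by whose covering numbers the supremum over
pairs is chained. -/
def prodDist (d : T → T → ℝ) (p q : T × T) : ℝ := max (d p.1 q.1) (d p.2 q.2)

variable {d : T → T → ℝ} {ε : ℝ}

lemma coveringNumber_prodDist_le_sq (h : coveringNumber d ε < ⊤) :
    coveringNumber (prodDist d) ε ≤ coveringNumber d ε ^ 2 := by
  obtain ⟨A, hA, A_encard⟩ := exists_encard_eq_coveringNumber h
  rw [← A_encard, sq, ← encard_prod]
  refine coveringNumber_le_encard fun p => ?_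
  obtain ⟨x, hx, hpx⟩ := hA p.1
  obtain ⟨y, hy, hpy⟩ := hA p.2
  exact ⟨(x, y), ⟨hx, hy⟩, max_le hpx hpy⟩

lemma logEntropy_prodDist_le (h : coveringNumber d ε < ⊤) :
    logEntropy (prodDist d) ε ≤ 2 * logEntropy d ε := by
  set N := (coveringNumber d ε).toNat with N_def
  have toNat_le : (coveringNumber (prodDist d) ε).toNat ≤ N ^ 2 := by
    refine ENat.toNat_le_of_le_natCast ((coveringNumber_prodDist_le_sq h).trans_eq ?_)
    rw [Nat.cast_pow, N_def, ENat.natCast_toNat h.ne]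
  rw [logEntropy, logEntropy, ← N_def, ← Nat.cast_ofNat, ← log_pow]
  gcongr
  have : ((coveringNumber (prodDist d) ε).toNat : ℝ) ≤ N ^ 2 := mod_cast toNat_le
  nlinarith [N.cast_nonneg (α := ℝ)]

end ProductCovering

section EuclideanCovering

variable {E : Type*} [NormedAddCommGroup E] [NormedSpace ℝ E] [FiniteDimensional ℝ E]

-- The open balls of radius `θ / 2` around the points of `s` are disjoint; compare volumes.
lemma card_le_of_isSeparated {s : Finset E} {R θ : ℝ≥0} (hθ : 0 < θ) (hR : ∀ x ∈ s, ‖x‖ ≤ R)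
    (hs : Metric.IsSeparated (θ : ℝ≥0∞) (s : Set E)) :
    (s.card : ℝ) ≤ (1 + 2 * R / θ) ^ finrank ℝ E := by
  borelize E
  let μ : Measure E := Measure.addHaar
  have hθ' : (0 : ℝ) < θ := hθ
  have balls_disjoint :
      (s : Set E).Pairwise (Function.onFun Disjoint fun x => Metric.ball x (θ / 2 : ℝ)) :=
    fun x hx y hy hxy => Metric.ball_disjoint_ball <| by
      have θ_lt : θ < nndist x y := by
        simpa only [edist_nndist, ENNReal.coe_lt_coe] using hs hx hy hxy
      rw [add_halves, ← coe_nndist]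
      exact θ_lt.le
  have balls_subset : ⋃ x ∈ s, Metric.ball x (θ / 2 : ℝ) ⊆ Metric.ball 0 (θ / 2 + R) :=
    iUnion₂_subset fun x hx => Metric.ball_subset_ball' (by
      rw [dist_zero_right]
      gcongr
      exact hR x hx)
  have volume_le : .ofReal (s.card * (θ / 2 : ℝ) ^ finrank ℝ E) * μ (Metric.ball 0 1) ≤
      .ofReal ((θ / 2 + R : ℝ) ^ finrank ℝ E) * μ (Metric.ball 0 1) := calc
    _ = ∑ x ∈ s, μ (Metric.ball x (θ / 2 : ℝ)) := by
      simp only [μ.addHaar_ball_of_pos _ (half_pos hθ'), Finset.sum_const, nsmul_eq_mul,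
        ENNReal.ofReal_mul (Nat.cast_nonneg _), ENNReal.ofReal_natCast, mul_assoc]
    _ = μ (⋃ x ∈ s, Metric.ball x (θ / 2 : ℝ)) :=
      (measure_biUnion_finset balls_disjoint fun _ _ => measurableSet_ball).symm
    _ ≤ μ (Metric.ball 0 (θ / 2 + R)) := measure_mono balls_subset
    _ = _ := μ.addHaar_ball_of_pos _ (by positivity)
  rw [ENNReal.mul_le_mul_iff_left (Metric.measure_ball_pos _ _ one_pos).ne' measure_ball_lt_top.ne,
    ENNReal.ofReal_le_ofReal_iff (by positivity), ← le_div_iff₀ (by positivity), ← div_pow]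
    at volume_le
  exact volume_le.trans_eq (by field_simp)

lemma coveringNumber_dist_le {X : Type*} [PseudoMetricSpace X] (T : Set X) (θ : ℝ≥0) :
    coveringNumber (fun x y : T => dist x y) θ ≤ Metric.coveringNumber θ T :=
  le_iInf fun C => le_iInf fun hCT => le_iInf fun hC => by
    rw [← encard_preimage_of_injective_subset_range Subtype.val_injective
      (hCT.trans_eq Subtype.range_coe.symm)]
    refine coveringNumber_le_encard fun x => ?_
    obtain ⟨y, hy, hxy⟩ := hC x.2
    exact ⟨⟨y, hCT hy⟩, hy, dist_le_coe.2 (edist_le_coe.1 hxy)⟩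

variable {T : Set E} {R θ : ℝ≥0}

lemma packingNumber_le (hθ : 0 < θ) (hR : ∀ x ∈ T, ‖x‖ ≤ R) :
    Metric.packingNumber θ T ≤ ⌊(1 + 2 * R / θ : ℝ) ^ finrank ℝ E⌋₊ := by
  refine iSup_le fun C => iSup_le fun hCT => iSup_le fun hC => ?_
  by_contra! hlt
  obtain ⟨s, hsC, hs⟩ := exists_subset_encard_eq (Order.add_one_le_of_lt hlt)
  lift s to Finset E using finite_of_encard_eq_coe (mod_cast hs)
  rw [encard_coe_eq_coe_finsetCard] at hs
  have := Nat.le_floor (card_le_of_isSeparated hθ (fun x hx => hR x (hCT (hsC hx)))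
    (hC.subset hsC))
  have : s.card = ⌊(1 + 2 * R / θ : ℝ) ^ finrank ℝ E⌋₊ + 1 := mod_cast hs
  omega

variable {d : T → T → ℝ} {L : ℝ≥0}

lemma coveringNumber_le_of_sq_le_mul_dist (hR : ∀ x ∈ T, ‖x‖ ≤ R) (hL : 0 < L)
    (hd : ∀ x y, d x y ^ 2 ≤ L * dist x y) {ε : ℝ} (hε : 0 < ε) :
    coveringNumber d ε ≤ ⌊(1 + 2 * R * L / ε ^ 2) ^ finrank ℝ E⌋₊ := by
  lift ε to ℝ≥0 using hε.le
  calc coveringNumber d ε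
    _ ≤ coveringNumber (fun x y : T => dist x y) ↑(ε ^ 2 / L) :=
      coveringNumber_mono fun x y hxy => (abs_le_of_sq_le_sq' ((hd x y).trans (by
        rwa [← le_div_iff₀' (by positivity)])) hε.le).2
    _ ≤ Metric.packingNumber (ε ^ 2 / L) T :=
      (coveringNumber_dist_le T _).trans (Metric.coveringNumber_le_packingNumber _ T)
    _ ≤ ⌊(1 + 2 * R * L / (ε : ℝ) ^ 2) ^ finrank ℝ E⌋₊ := by
      have := packingNumber_le (div_pos (pow_pos (mod_cast hε) 2) hL) hR
      rwa [NNReal.coe_div, NNReal.coe_pow, div_div_eq_mul_div] at this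

lemma logEntropy_le_of_sq_le_mul_dist (hR : ∀ x ∈ T, ‖x‖ ≤ R) (hL : 0 < L)
    (hd : ∀ x y, d x y ^ 2 ≤ L * dist x y) {ε Δ : ℝ} (hε : 0 < ε) (hεΔ : ε ≤ Δ) :
    logEntropy d ε ≤ log 2 + finrank ℝ E * (log (Δ ^ 2 + 2 * R * L) - 2 * log ε) := by
  set m := finrank ℝ E
  have hΔ : 0 < Δ := hε.trans_le hεΔ
  have covering_le : ((coveringNumber d ε).toNat : ℝ) ≤ (1 + 2 * R * L / ε ^ 2) ^ m :=
    (Nat.le_floor_iff (by positivity)).1 (ENat.toNat_le_of_le_natCast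
      (coveringNumber_le_of_sq_le_mul_dist hR hL hd hε))
  have base_le : 1 + 2 * R * L / ε ^ 2 ≤ (Δ ^ 2 + 2 * R * L) / ε ^ 2 := by
    rw [add_div]
    gcongr
    exact (one_le_div (by positivity)).2 (by gcongr)
  have one_le_base : (1 : ℝ) ≤ 1 + 2 * R * L / ε ^ 2 := le_add_of_nonneg_right (by positivity)
  calc log ((coveringNumber d ε).toNat + 1)
    _ ≤ log (2 * ((Δ ^ 2 + 2 * R * L) / ε ^ 2) ^ m) := by
      gcongr
      linarith [pow_le_pow_left₀ (by positivity) base_le m, one_le_pow₀ one_le_base (n := m)]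
    _ = log 2 + m * (log (Δ ^ 2 + 2 * R * L) - 2 * log ε) := by
      rw [log_mul two_ne_zero (by positivity), log_pow,
        log_div (by positivity) (by positivity), log_pow]
      norm_cast

lemma intervalIntegrable_logEntropy (hR : ∀ x ∈ T, ‖x‖ ≤ R) (hL : 0 < L)
    (hd : ∀ x y, d x y ^ 2 ≤ L * dist x y) {Δ : ℝ} (hΔ : 0 ≤ Δ) :
    IntervalIntegrable (logEntropy d) volume 0 Δ := by
  have majorant_integrable : IntervalIntegrable (fun ε =>
      log 2 + finrank ℝ E * (log (Δ ^ 2 + 2 * R * L) - 2 * log ε)) volume 0 Δ :=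
    intervalIntegrable_const.add ((intervalIntegrable_const.sub
      (intervalIntegral.intervalIntegrable_log'.const_mul 2)).const_mul _)
  have logEntropy_antitone : AntitoneOn (logEntropy d) (Ioc 0 Δ) :=
    (antitoneOn_logEntropy fun ε hε => (coveringNumber_le_of_sq_le_mul_dist hR hL hd hε).trans_lt
      (ENat.natCast_lt_top _)).mono Ioc_subset_Ioi_self
  rw [intervalIntegrable_iff_integrableOn_Ioc_of_le hΔ] at majorant_integrable ⊢
  refine majorant_integrable.mono'
    (aemeasurable_restrict_of_antitoneOn measurableSet_Ioc logEntropy_antitone).aestronglyMeasurable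
    (ae_restrict_of_forall_mem measurableSet_Ioc fun ε hε => ?_)
  rw [norm_of_nonneg logEntropy_nonneg]
  exact logEntropy_le_of_sq_le_mul_dist hR hL hd hε.1 hε.2

end EuclideanCovering

section CanonicalDist

variable {T Ω : Type*} [MeasurableSpace Ω] {P : Measure Ω} {f : T → Ω → ℝ}

lemma sq_canonicalDist (s t : T) : canonicalDist f P s t ^ 2 = ∫ ω, (f s ω - f t ω) ^ 2 ∂P :=
  sq_sqrt (integral_nonneg fun _ => sq_nonneg _)

lemma canonicalDist_nonneg (s t : T) : 0 ≤ canonicalDist f P s t := sqrt_nonneg _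

lemma canonicalDist_self (t : T) : canonicalDist f P t t = 0 := by simp [canonicalDist]

lemma canonicalDist_comm (s t : T) : canonicalDist f P s t = canonicalDist f P t s := by
  simp only [canonicalDist, sub_sq_comm]

variable (P f) in
lemma diam_canonicalDist_nonneg : 0 ≤ diam (canonicalDist f P) :=
  iSup_nonneg fun p => canonicalDist_nonneg p.1 p.2

lemma isGaussianProcess_increments (hf : IsGaussianProcess f P) :
    IsGaussianProcess (fun (p : T × T) ω => f p.1 ω - f p.2 ω) P := by
  classical
  exact hf.of_isGaussianProcess fun p => ⟨{p.1, p.2},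
    ContinuousLinearMap.proj ⟨p.1, by simp⟩ - ContinuousLinearMap.proj ⟨p.2, by simp⟩,
    fun ω => by simp⟩

lemma memLp_two_increment (hf : IsGaussianProcess f P) (s t : T) :
    MemLp (fun ω => f s ω - f t ω) 2 P :=
  ((isGaussianProcess_increments hf).hasGaussianLaw_eval (s, t)).memLp_two

lemma integral_sq_add_increments_le (hf : IsGaussianProcess f P) {s t s' t' : T} {r : ℝ}
    (h : canonicalDist f P s t ≤ r) (h' : canonicalDist f P s' t' ≤ r) :
    ∫ ω, ((f s ω - f t ω) + (f s' ω - f t' ω)) ^ 2 ∂P ≤ (2 * r) ^ 2 := by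
  have hst := memLp_two_increment hf s t
  have hst' := memLp_two_increment hf s' t'
  calc ∫ ω, ((f s ω - f t ω) + (f s' ω - f t' ω)) ^ 2 ∂P
    _ ≤ ∫ ω, 2 * ((f s ω - f t ω) ^ 2 + (f s' ω - f t' ω) ^ 2) ∂P :=
      integral_mono (hst.add hst').integrable_sq
        ((hst.integrable_sq.add hst'.integrable_sq).const_mul 2) fun ω => add_sq_le
    _ = 2 * (canonicalDist f P s t ^ 2 + canonicalDist f P s' t' ^ 2) := by
      rw [integral_const_mul, integral_add hst.integrable_sq hst'.integrable_sq,
        sq_canonicalDist, sq_canonicalDist]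
    _ ≤ 2 * (r ^ 2 + r ^ 2) := by
      gcongr <;> exact canonicalDist_nonneg _ _
    _ = (2 * r) ^ 2 := by ring

end CanonicalDist

section Deviation

variable {T Ω : Type*} {k : ℕ}

/-- The deviation `‖h^k(x) - h^k(y)‖² - D(x,y)²` at the pair `p = (x, y)`, whose supremum
`supDeviation` controls. -/
noncomputable def deviation (F : Fin k → T → Ω → ℝ) (D : T → T → ℝ) (p : T × T) (ω : Ω) : ℝ :=
  ‖embed F p.1 ω - embed F p.2 ω‖ ^ 2 - D p.1 p.2 ^ 2

/-- The contribution of one copy `g` of the process to the increment of the deviation from the pair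
`q` to the pair `p`, centered when `D` is the canonical distance, and divided by a scale `a`. -/
noncomputable def incrementTerm (D : T → T → ℝ) (p q : T × T) (a : ℝ) (g : T → ℝ) : ℝ :=
  ((g p.1 - g p.2) ^ 2 - (g q.1 - g q.2) ^ 2 - (D p.1 p.2 ^ 2 - D q.1 q.2 ^ 2)) / a

variable {F : Fin k → T → Ω → ℝ} {D : T → T → ℝ}

lemma supDeviation_eq_biSup_enorm (S : Set T) (ω : Ω) :
    supDeviation F D S ω = ⨆ p ∈ S ×ˢ S, ‖deviation F D p ω‖ₑ := by
  simp only [biSup_prod, enorm_eq_ofReal_abs, supDeviation, deviation]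

lemma deviation_eq_average_sub (p : T × T) (ω : Ω) :
    deviation F D p ω = (∑ i, (F i p.1 ω - F i p.2 ω) ^ 2) / k - D p.1 p.2 ^ 2 := by
  rw [deviation, embed, embed, ← smul_sub, norm_smul, mul_pow, EuclideanSpace.norm_sq_eq,
    norm_of_nonneg (by positivity), div_pow, sq_sqrt (Nat.cast_nonneg k), one_pow,
    one_div_mul_eq_div]
  simp only [PiLp.sub_apply, norm_eq_abs, sq_abs]

lemma deviation_self (hD : ∀ x, D x x = 0) (x : T) (ω : Ω) : deviation F D (x, x) ω = 0 := by
  simp [deviation, hD]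

lemma deviation_sub_deviation (hk : 0 < k) (p q : T × T) {a : ℝ} (ha : a ≠ 0) (ω : Ω) :
    deviation F D p ω - deviation F D q ω =
      a / k * ∑ i, incrementTerm D p q a (fun t => F i t ω) := by
  simp only [deviation_eq_average_sub, incrementTerm, ← Finset.sum_div, Finset.sum_sub_distrib,
    Finset.sum_const, Finset.card_univ, Fintype.card_fin, nsmul_eq_mul]
  field_simp
  ring

lemma measurable_incrementTerm (p q : T × T) (a : ℝ) : Measurable (incrementTerm D p q a) := by
  unfold incrementTerm
  fun_prop

end Deviation

section GaussianIncrements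

variable {T Ω : Type*} [MeasurableSpace Ω] {P : Measure Ω} {f : T → Ω → ℝ}

lemma integrable_sq_sub_sq (hf : IsGaussianProcess f P) (p q : T × T) :
    Integrable (fun ω => (f p.1 ω - f p.2 ω) ^ 2 - (f q.1 ω - f q.2 ω) ^ 2) P :=
  (memLp_two_increment hf _ _).integrable_sq.sub (memLp_two_increment hf _ _).integrable_sq

lemma integral_sq_sub_sq (hf : IsGaussianProcess f P) (p q : T × T) :
    ∫ ω, ((f p.1 ω - f p.2 ω) ^ 2 - (f q.1 ω - f q.2 ω) ^ 2) ∂P =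
      canonicalDist f P p.1 p.2 ^ 2 - canonicalDist f P q.1 q.2 ^ 2 := by
  rw [integral_sub (memLp_two_increment hf _ _).integrable_sq
    (memLp_two_increment hf _ _).integrable_sq, sq_canonicalDist, sq_canonicalDist]

variable [IsProbabilityMeasure P]

lemma integral_incrementTerm (hf : IsGaussianProcess f P) (p q : T × T) (a : ℝ) :
    ∫ ω, incrementTerm (canonicalDist f P) p q a (fun t => f t ω) ∂P = 0 := by
  simp only [incrementTerm]
  rw [integral_div, integral_sub (integrable_sq_sub_sq hf p q) (integrable_const _),
    integral_sq_sub_sq hf, integral_const, probReal_univ, one_smul, sub_self, zero_div]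

/- A difference of squares is the product of a sum and a difference: here the factors are Gaussian
of `L²` norm at most `2 r` and `2 δ`. -/
lemma lintegral_exp_abs_sq_sub_sq_le (hf : IsGaussianProcess f P) {δ r : ℝ} {p q : T × T}
    (hp : canonicalDist f P p.1 p.2 ≤ δ) (hq : canonicalDist f P q.1 q.2 ≤ δ)
    (hpq : prodDist (canonicalDist f P) p q ≤ r) :
    ∫⁻ ω, .ofReal (exp |((f p.1 ω - f p.2 ω) ^ 2 - (f q.1 ω - f q.2 ω) ^ 2) / (36 * δ * r)|) ∂P
      ≤ 2 := by
  have increments := isGaussianProcess_increments hf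
  have difference_le := lintegral_exp_sq_le_two
    (increments.hasGaussianLaw_fun_add (s := (p.1, q.1)) (t := (q.2, p.2)))
    (integral_sq_add_increments_le hf (max_le_iff.1 hpq).1
      ((canonicalDist_comm _ _).trans_le (max_le_iff.1 hpq).2))
  have sum_le := lintegral_exp_sq_le_two (increments.hasGaussianLaw_fun_add (s := p) (t := q))
    (integral_sq_add_increments_le hf hp hq)
  have product_le := lintegral_exp_abs_mul_le
    ((increments.hasGaussianLaw_fun_add (s := (p.1, q.1)) (t := (q.2, p.2))).aemeasurable.div_const
      (3 * (2 * r))) difference_le sum_le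
  convert product_le using 6
  ring

lemma lintegral_exp_abs_incrementTerm_le (hf : IsGaussianProcess f P) {δ r : ℝ} {p q : T × T}
    (hp : canonicalDist f P p.1 p.2 ≤ δ) (hq : canonicalDist f P q.1 q.2 ≤ δ)
    (hpq : prodDist (canonicalDist f P) p q ≤ r) :
    ∫⁻ ω, .ofReal (exp |incrementTerm (canonicalDist f P) p q (36 * δ * r) (fun t => f t ω)|) ∂P ≤
      ↑(2 * (exp (2 : ℝ≥0)).toNNReal) := by
  have centered_le := lintegral_exp_abs_sub_integral_le (B := 2)
    ((integrable_sq_sub_sq hf p q).aemeasurable.div_const (36 * δ * r))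
    (lintegral_exp_abs_sq_sub_sq_le hf hp hq hpq)
  rw [integral_div, integral_sq_sub_sq hf] at centered_le
  simpa only [incrementTerm, sub_div] using centered_le

end GaussianIncrements

section IndependentCopies

variable {T Ω Ω' : Type*} [MeasurableSpace Ω] [MeasurableSpace Ω'] {P : Measure Ω}
  {P' : Measure Ω'} {f : T → Ω' → ℝ} {k : ℕ} {F : Fin k → T → Ω → ℝ}

lemma aemeasurable_deviation (hF : IsIndepCopies F P f P') (D : T → T → ℝ) (p : T × T) :
    AEMeasurable (deviation F D p) P := by
  have (i : Fin k) (t : T) : AEMeasurable (F i t) P :=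
    (measurable_pi_apply t).comp_aemeasurable (hF.identDistrib i).aemeasurable_fst
  rw [funext (deviation_eq_average_sub p)]
  fun_prop

/-- A bound on the exponential moments of the increments of the deviation at scale
`72 δ / √k · prodDist D`, where `δ` bounds the canonical distance `D`. -/
noncomputable def incrementMoment : ℝ≥0 :=
  (2 * exp (2 * (2 * (exp (2 : ℝ≥0)).toNNReal : ℝ≥0))).toNNReal

lemma hasSubexpIncrements_deviation [IsProbabilityMeasure P] [IsProbabilityMeasure P']
    (hf : IsGaussianProcess f P') (hF : IsIndepCopies F P f P') (hk : 0 < k) {δ : ℝ} (hδ : 0 < δ)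
    (hDδ : ∀ x y, canonicalDist f P' x y ≤ δ) :
    HasSubexpIncrements (deviation F (canonicalDist f P')) (prodDist (canonicalDist f P'))
      (72 * δ / √k) incrementMoment P where
  scale_pos := by positivity
  aemeasurable_dist p q := by
    simp only [dist_eq]
    have := aemeasurable_deviation hF (canonicalDist f P')
    fun_prop
  lintegral_exp_le p q r hr hpq := by
    let φ := incrementTerm (canonicalDist f P') p q (36 * δ * r)
    have φ_meas : Measurable φ := measurable_incrementTerm p q _
    have φ_copies (i : Fin k) : IdentDistrib (fun ω => φ (fun t => F i t ω))
        (fun ω => φ (fun t => f t ω)) P P' := (hF.identDistrib i).comp φ_meas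
    have φ_indep : iIndepFun (fun i ω => φ (fun t => F i t ω)) P :=
      hF.indep.comp (fun _ => φ) fun _ => φ_meas
    have exp_abs_meas : Measurable fun x : ℝ => ENNReal.ofReal (exp |x|) := by fun_prop
    have average_le := lintegral_exp_abs_sum_div_le φ_indep
      (fun i => (φ_copies i).aemeasurable_fst)
      (fun i => ((φ_copies i).comp exp_abs_meas).lintegral_eq.trans_le
        (lintegral_exp_abs_incrementTerm_le hf (hDδ _ _) (hDδ _ _) hpq))
      (fun i => (φ_copies i).integral_eq.trans (integral_incrementTerm hf p q _))
    rw [Fintype.card_fin] at average_le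
    refine (lintegral_congr fun ω => ?_).trans_le average_le
    congr 2
    rw [dist_eq, deviation_sub_deviation hk p q (by positivity : 36 * δ * r ≠ 0), abs_mul,
      abs_of_pos (by positivity)]
    have : (√k) ^ 2 = k := sq_sqrt (Nat.cast_nonneg k)
    field_simp
    rw [this]
    ring

end IndependentCopies

section SupDeviation

variable {T Ω Ω' : Type*} [MeasurableSpace Ω] [MeasurableSpace Ω'] {P : Measure Ω}
  {P' : Measure Ω'} {f : T → Ω' → ℝ} {k : ℕ} {F : Fin k → T → Ω → ℝ}

lemma aemeasurable_supDeviation (hF : IsIndepCopies F P f P') (D : T → T → ℝ) {S : Set T}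
    (hS : S.Countable) : AEMeasurable (supDeviation F D S) P := by
  rw [funext (supDeviation_eq_biSup_enorm S)]
  exact .biSup _ (hS.prod hS) fun p _ => (aemeasurable_deviation hF D p).enorm

lemma lintegral_logEntropy_prodDist_le {d : T → T → ℝ} {Δ : ℝ} (hΔ : 0 ≤ Δ)
    (hN : ∀ ε, 0 < ε → coveringNumber d ε < ⊤)
    (hint : IntervalIntegrable (logEntropy d) volume 0 Δ) :
    ∫⁻ ε in Ioc 0 Δ, .ofReal (logEntropy (prodDist d) ε) ≤
      .ofReal (2 * ∫ ε in (0 : ℝ)..Δ, logEntropy d ε) := by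
  rw [← intervalIntegral.integral_const_mul, intervalIntegral.integral_of_le hΔ,
    ofReal_integral_eq_lintegral_ofReal (hint.const_mul 2).1
      (.of_forall fun _ => mul_nonneg zero_le_two logEntropy_nonneg)]
  exact setLIntegral_mono' measurableSet_Ioc fun ε hε =>
    ENNReal.ofReal_le_ofReal (logEntropy_prodDist_le (hN ε hε.1))

variable [IsProbabilityMeasure P] [IsProbabilityMeasure P']

lemma lintegral_supDeviation_le_of_canonicalDist_le (hf : IsGaussianProcess f P')
    (hF : IsIndepCopies F P f P') (hk : 0 < k) {Δ δ : ℝ} (hΔ : 0 ≤ Δ) (hδ : 0 < δ) (hΔδ : Δ ≤ δ)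
    (hDΔ : ∀ x y, canonicalDist f P' x y ≤ Δ)
    (hN : ∀ ε, 0 < ε → coveringNumber (canonicalDist f P') ε < ⊤)
    (hint : IntervalIntegrable (logEntropy (canonicalDist f P')) volume 0 Δ)
    {S : Set T} (hS : S.Countable) :
    ∫⁻ ω, supDeviation F (canonicalDist f P') S ω ∂P ≤ .ofReal (576 * (1 + 2 * incrementMoment) *
      (δ / √k * ∫ ε in (0 : ℝ)..Δ, logEntropy (canonicalDist f P') ε)) := by
  set D := canonicalDist f P'
  obtain rfl | ⟨x, -⟩ := S.eq_empty_or_nonempty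
  · simp [supDeviation]
  have prod_covering (ε : ℝ) (hε : 0 < ε) : coveringNumber (prodDist D) ε < ⊤ :=
    (coveringNumber_prodDist_le_sq (hN ε hε)).trans_lt
      (ENat.pow_ne_top_iff.2 (.inl (hN ε hε).ne)).lt_top
  calc ∫⁻ ω, supDeviation F D S ω ∂P
    _ = ∫⁻ ω, ⨆ p ∈ S ×ˢ S, edist (deviation F D p ω) (deviation F D (x, x) ω) ∂P := by
      simp only [supDeviation_eq_biSup_enorm, deviation_self canonicalDist_self, D,
        edist_zero_right]
    _ ≤ 4 * .ofReal ((1 + 2 * incrementMoment) * (72 * δ / √k)) *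
        ∫⁻ ε in Ioc 0 Δ, .ofReal (logEntropy (prodDist D) ε) :=
      (hasSubexpIncrements_deviation hf hF hk hδ fun x y => (hDΔ x y).trans hΔδ)
        |>.lintegral_biSup_edist_le prod_covering hΔ (fun p => max_le (hDΔ _ _) (hDΔ _ _))
          (hS.prod hS)
    _ ≤ 4 * .ofReal ((1 + 2 * incrementMoment) * (72 * δ / √k)) *
        .ofReal (2 * ∫ ε in (0 : ℝ)..Δ, logEntropy D ε) := by
      gcongr
      exact lintegral_logEntropy_prodDist_le hΔ hN hint
    _ = _ := by
      rw [← ENNReal.ofReal_ofNat, ← ENNReal.ofReal_mul (by norm_num),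
        ← ENNReal.ofReal_mul (by positivity)]
      congr 1
      ring

lemma lintegral_supDeviation_le (hf : IsGaussianProcess f P') (hF : IsIndepCopies F P f P')
    (hk : 0 < k) (hbdd : BddAbove (range fun p : T × T => canonicalDist f P' p.1 p.2))
    (hN : ∀ ε, 0 < ε → coveringNumber (canonicalDist f P') ε < ⊤)
    (hint : IntervalIntegrable (logEntropy (canonicalDist f P')) volume 0
      (diam (canonicalDist f P'))) {S : Set T} (hS : S.Countable) :
    ∫⁻ ω, supDeviation F (canonicalDist f P') S ω ∂P ≤
      .ofReal (576 * (1 + 2 * incrementMoment) * entropyBound (canonicalDist f P') k) := by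
  have dist_le_diam (x y : T) : canonicalDist f P' x y ≤ diam (canonicalDist f P') :=
    le_ciSup hbdd (x, y)
  obtain hdiam | hdiam := (diam_canonicalDist_nonneg P' f).eq_or_lt
  · rw [← hdiam] at dist_le_diam hint
    simpa [entropyBound, ← hdiam] using lintegral_supDeviation_le_of_canonicalDist_le hf hF hk
      le_rfl one_pos zero_le_one dist_le_diam hN hint hS
  · exact lintegral_supDeviation_le_of_canonicalDist_le hf hF hk hdiam.le hdiam le_rfl
      dist_le_diam hN hint hS

end SupDeviation

section Covariance

variable {T Ω : Type*} [MeasurableSpace Ω] {P : Measure Ω} {f : T → Ω → ℝ}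

lemma sq_canonicalDist_eq_covFun (hf : IsGaussianProcess f P) (s t : T) :
    canonicalDist f P s t ^ 2 = covFun f P s s - 2 * covFun f P s t + covFun f P t t := by
  have mul_integrable (s t : T) : Integrable (fun ω => f s ω * f t ω) P :=
    (hf.hasGaussianLaw_eval s).memLp_two.integrable_mul (hf.hasGaussianLaw_eval t).memLp_two
  rw [sq_canonicalDist, covFun, covFun, covFun, ← integral_const_mul,
    ← integral_sub (mul_integrable s s) ((mul_integrable s t).const_mul 2),
    ← integral_add _ (mul_integrable t t)]
  · congr with ω
    ring
  · exact (mul_integrable s s).sub ((mul_integrable s t).const_mul 2)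

variable [PseudoMetricSpace T] {L : ℝ≥0}

lemma sq_canonicalDist_le_mul_dist (hf : IsGaussianProcess f P)
    (hL : LipschitzWith L fun p : T × T => covFun f P p.1 p.2) (s t : T) :
    canonicalDist f P s t ^ 2 ≤ 2 * L * dist s t := by
  have diag_s := (le_abs_self _).trans (hL.dist_le_mul (s, s) (s, t))
  have diag_t := (le_abs_self _).trans (hL.dist_le_mul (t, t) (s, t))
  simp only [Prod.dist_eq, dist_self, dist_nonneg, sup_of_le_left, sup_of_le_right, dist_comm t s]
    at diag_s diag_t
  rw [sq_canonicalDist_eq_covFun hf]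
  linarith

lemma continuous_sq_canonicalDist (hf : IsGaussianProcess f P)
    (hC : Continuous fun p : T × T => covFun f P p.1 p.2) :
    Continuous fun p : T × T => canonicalDist f P p.1 p.2 ^ 2 := by
  simp only [sq_canonicalDist_eq_covFun hf]
  exact ((hC.comp (by fun_prop : Continuous fun p : T × T => (p.1, p.1))).sub
    (hC.const_mul 2)).add (hC.comp (by fun_prop : Continuous fun p : T × T => (p.2, p.2)))

lemma bddAbove_range_canonicalDist [BoundedSpace T] (hf : IsGaussianProcess f P)
    (hL : LipschitzWith L fun p : T × T => covFun f P p.1 p.2) :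
    BddAbove (range fun p : T × T => canonicalDist f P p.1 p.2) := by
  refine ⟨√(2 * L * Metric.diam (univ : Set T)), forall_mem_range.2 fun p => ?_⟩
  refine le_sqrt_of_sq_le ((sq_canonicalDist_le_mul_dist hf hL p.1 p.2).trans ?_)
  gcongr
  exact Metric.dist_le_diam_of_mem BoundedSpace.bounded_univ (mem_univ _) (mem_univ _)

end Covariance

section ContinuousPaths

variable {T Ω : Type*} [TopologicalSpace T] [MeasurableSpace Ω] {P : Measure Ω} {k : ℕ}
  {F : Fin k → T → Ω → ℝ} {D : T → T → ℝ}

lemma supDeviation_ae_eq_univ_of_dense (hD : Continuous fun p : T × T => D p.1 p.2 ^ 2) {S : Set T}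
    (hS : Dense S) (hF : ∀ᵐ ω ∂P, ∀ i, Continuous fun t => F i t ω) :
    supDeviation F D S =ᵐ[P] supDeviation F D univ := by
  filter_upwards [hF] with ω hω
  have deviation_continuous : Continuous fun p => deviation F D p ω := by
    simp only [deviation_eq_average_sub]
    fun_prop
  rw [supDeviation_eq_biSup_enorm, supDeviation_eq_biSup_enorm, univ_prod_univ, iSup_univ,
    ← iSup_subtype'']
  exact (hS.prod hS).ciSup' deviation_continuous.enorm

end ContinuousPaths

end GPEmbedding

open GPEmbedding in
theorem theorem2p7_general :
    ∃ c : ℝ, 0 < c ∧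
      ∀ (E : Type*) [NormedAddCommGroup E] [NormedSpace ℝ E] [FiniteDimensional ℝ E]
        (k : ℕ) (_ : 0 < k) (T : Set E) (_ : Bornology.IsBounded T)
        (Ω' : Type*) [MeasurableSpace Ω'] (P' : Measure Ω') [IsProbabilityMeasure P']
        (f : T → Ω' → ℝ) (_ : IsGaussianProcess f P')
        (_ : ∃ L : ℝ≥0, LipschitzWith L (fun p : T × T => covFun f P' p.1 p.2))
        (Ω : Type*) [MeasurableSpace Ω] (P : Measure Ω) [IsProbabilityMeasure P]
        (F : Fin k → T → Ω → ℝ) (_ : IsIndepCopies F P f P')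
        (D : T → T → ℝ) (_ : D = canonicalDist f P'),
        BddAbove (Set.range fun p : T × T => D p.1 p.2) ∧
        (∀ ε : ℝ, 0 < ε → coveringNumber D ε < ⊤) ∧
        IntervalIntegrable (logEntropy D) volume 0 (diam D) ∧
        (∀ S : Set T, S.Countable →
          ∫⁻ ω, supDeviation F D S ω ∂P ≤
            ENNReal.ofReal (c * entropyBound D k)) ∧
        ((∀ᵐ ω ∂P, ∀ i, Continuous fun t => F i t ω) →
          AEMeasurable (supDeviation F D Set.univ) P ∧
          ∫⁻ ω, supDeviation F D Set.univ ω ∂P ≤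
            ENNReal.ofReal (c * entropyBound D k)) := by
  refine ⟨576 * (1 + 2 * incrementMoment), by positivity, ?_⟩
  rintro E _ _ _ k hk T hT Ω' _ P' _ f hf ⟨L, hL⟩ Ω _ P _ F hF _ rfl
  have : BoundedSpace T := boundedSpace_subtype_iff.2 hT
  have := FiniteDimensional.proper_real E
  have hC : LipschitzWith (L + 1) fun p : T × T => covFun f P' p.1 p.2 :=
    hL.weaken (le_add_of_nonneg_right zero_le_one)
  obtain ⟨R, hR⟩ := hT.exists_norm_le
  have hR' (x : E) (hx : x ∈ T) : ‖x‖ ≤ R.toNNReal := (hR x hx).trans R.le_coe_toNNReal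
  have hsq (x y : T) : canonicalDist f P' x y ^ 2 ≤ ↑(2 * (L + 1)) * dist x y := by
    simpa using sq_canonicalDist_le_mul_dist hf hC x y
  have hbdd := bddAbove_range_canonicalDist hf hL
  have hN (ε : ℝ) (hε : 0 < ε) : coveringNumber (canonicalDist f P') ε < ⊤ :=
    (coveringNumber_le_of_sq_le_mul_dist hR' (by positivity) hsq hε).trans_lt
      (ENat.natCast_lt_top _)
  have hint := intervalIntegrable_logEntropy hR' (by positivity) hsq
    (diam_canonicalDist_nonneg P' f)
  have hcountable (S : Set T) (hS : S.Countable) :=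
    lintegral_supDeviation_le hf hF hk hbdd hN hint hS
  refine ⟨hbdd, hN, hint, hcountable, fun hpaths => ?_⟩
  obtain ⟨S, hS, S_dense⟩ := TopologicalSpace.exists_countable_dense T
  have sup_eq := supDeviation_ae_eq_univ_of_dense
    (continuous_sq_canonicalDist hf hL.continuous) S_dense hpaths
  exact ⟨(aemeasurable_supDeviation hF _ hS).congr sup_eq,
    (lintegral_congr_ae sup_eq).symm.trans_le (hcountable S hS)⟩

theorem theorem2p7 :
    ∃ c : ℝ, 0 < c ∧
      ∀ (n k : ℕ) (_ : 0 < k) (T : Set (EuclideanSpace ℝ (Fin n))) (_ : IsCompact T)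
        (Ω' : Type*) [MeasurableSpace Ω'] (P' : Measure Ω') [IsProbabilityMeasure P']
        (f : T → Ω' → ℝ) (_ : IsGaussianProcess f P') (_ : ∀ t, ∫ ω, f t ω ∂P' = 0)
        (_ : ∃ L : ℝ≥0, LipschitzWith L (fun p : T × T => GPEmbedding.covFun f P' p.1 p.2))
        (Ω : Type*) [MeasurableSpace Ω] (P : Measure Ω) [IsProbabilityMeasure P]
        (F : Fin k → T → Ω → ℝ) (_ : GPEmbedding.IsIndepCopies F P f P')
        (D : T → T → ℝ) (_ : D = GPEmbedding.canonicalDist f P'),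
        -- the right-hand side is well defined and finite
        BddAbove (Set.range fun p : T × T => D p.1 p.2) ∧
        (∀ ε : ℝ, 0 < ε → GPEmbedding.coveringNumber D ε < ⊤) ∧
        IntervalIntegrable (GPEmbedding.logEntropy D) volume 0 (GPEmbedding.diam D) ∧
        -- the bound over every countable set of parameters, for any version of the process
        (∀ S : Set T, S.Countable →
          ∫⁻ ω, GPEmbedding.supDeviation F D S ω ∂P ≤
            ENNReal.ofReal (c * GPEmbedding.entropyBound D k)) ∧
        -- the bound over all of `T`, for the version with continuous sample paths
        ((∀ᵐ ω ∂P, ∀ i, Continuous fun t => F i t ω) →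
          AEMeasurable (GPEmbedding.supDeviation F D Set.univ) P ∧
          ∫⁻ ω, GPEmbedding.supDeviation F D Set.univ ω ∂P ≤
            ENNReal.ofReal (c * GPEmbedding.entropyBound D k)) := by
  obtain ⟨c, hc, h⟩ := theorem2p7_general
  exact ⟨c, hc, fun n k hk T hT Ω' _ P' _ f hf _ => h _ k hk T hT.isBounded Ω' P' f hf⟩
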